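/- Let $G=\{g_1,\dots,g_n\}$ be a finite group with identity $e$, and let $\chi_r$ ($r=1,\dots,m$) be its distinct irreducible complex characters. Let $f:G\to\mathbb{C}$ be a class function, i.e. $f(h^{-1}gh)=f(g)$ for all $g,h\in G$. Then there are unique coefficients $p_r\in\mathbb{C}$ with $f=\sum_r p_r\chi_r$, and the $G$-circulant matrix $A\in\mathbb{C}^{n\times n}$ with entries $$A_{ij}=f(g_ig_j^{-1})=\sum_r p_r\,\chi_r(g_ig_j^{-1})$$ is positive semidefinite (that is, Hermitian with $v^*Av\ge 0$ for all $v\in\mathbb{C}^n$) if and only if every $p_r$ is a nonnegative real number. Moreover, the matrices $E_r=\frac{\chi_r(e)}{|G|}\bigl(\chi_r(g_ig_j^{-1})\bigr)_{i,j=1}^n$ are orthogonal projections ($E_r^*=E_r=E_r^2$), they are mutually orthogonal ($E_rE_s=0$ for $r\ne s$), and $E_r$ has rank $\chi_r(e)^2$. -/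

import Mathlib

open scoped ComplexOrder

/-- `χ : G → ℂ` is an irreducible complex character of `G`: the character (trace function) of an
irreducible finite-dimensional complex representation of `G`. Every such representation is
isomorphic to one on some `ℂⁿ`, and isomorphic representations have the same character. -/
def IsIrrChar (G : Type*) [Group G] (χ : G → ℂ) : Prop :=
  ∃ (d : ℕ) (ρ : Representation ℂ G (Fin d → ℂ)), ρ.IsIrreducible ∧ ρ.character = χ

/-- The type of (distinct) irreducible complex characters of `G`. -/
abbrev IrrChar (G : Type*) [Group G] : Type _ := {χ : G → ℂ // IsIrrChar G χ}

instance IrrChar.instCoeFun (G : Type*) [Group G] : CoeFun (IrrChar G) (fun _ => G → ℂ) :=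
  ⟨fun χ => χ.1⟩

/-- Orthogonality relations for irreducible characters. -/
theorem IrrChar.sum_mul_inv {G : Type*} [Group G] [Fintype G] (χ ψ : IrrChar G) [Decidable (χ = ψ)] :
    ∑ g : G, χ g * ψ g⁻¹ = if χ = ψ then (Nat.card G : ℂ) else 0 := by
  obtain ⟨d, ρ, hρ, hχ⟩ := χ.2
  obtain ⟨e, σ, hσ, hψ⟩ := ψ.2
  have hc : (Nat.card G : ℂ) ≠ 0 := by simp
  let : Invertible (Nat.card G : ℂ) := invertibleOfNonzero hc
  have h := Representation.char_orthonormal ρ σ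
  have h2 := Representation.char_orthonormal ρ ρ
  rw [inv_mul_eq_iff_eq_mul₀ hc, if_pos ⟨Representation.Equiv.refl ρ⟩, hχ] at h2
  rw [inv_mul_eq_iff_eq_mul₀ hc, hχ, hψ] at h
  by_cases hE : Nonempty (σ.Equiv ρ)
  · obtain ⟨φ⟩ := hE
    have hEq : χ = ψ := Subtype.ext (hχ.symm.trans ((Representation.char_iso φ).symm.trans hψ))
    rw [if_pos ⟨φ⟩, mul_one] at h
    rw [if_pos hEq, h]
  · rw [if_neg hE, mul_zero] at h
    have hne : χ ≠ ψ := by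
      rintro rfl
      rw [h2, mul_one] at h
      exact hc h
    rw [if_neg hne, h]

/-- A finite group has only finitely many irreducible characters. -/
instance IrrChar.instFinite (G : Type*) [Group G] [Finite G] : Finite (IrrChar G) := by
  classical
  have := Fintype.ofFinite G
  have hli : LinearIndependent ℂ (fun χ : IrrChar G => (χ : G → ℂ)) := by
    rw [linearIndependent_iff']
    intro s c hc ψ hψ
    have h : ∑ g : G, (∑ χ ∈ s, c χ • (χ : G → ℂ)) g * ψ g⁻¹ = 0 := by
      rw [hc]; simp
    simp only [Finset.sum_apply, Pi.smul_apply, smul_eq_mul, Finset.sum_mul, mul_assoc] at h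
    rw [Finset.sum_comm] at h
    simp only [← Finset.mul_sum, IrrChar.sum_mul_inv] at h
    simpa [hψ] using h
  exact hli.finite

noncomputable instance IrrChar.instFintype (G : Type*) [Group G] [Finite G] :
    Fintype (IrrChar G) := Fintype.ofFinite _

/-- A class function: constant on conjugacy classes. -/
def IsClassFunction {G : Type*} [Group G] (f : G → ℂ) : Prop :=
  ∀ g h : G, f (h⁻¹ * g * h) = f g

/-- The matrix with entries `f (gᵢ gⱼ⁻¹)`, for an enumeration `g` of the elements of `G`. It is
called `G`-circulant when `f` is a class function. -/
def gCirculant {G : Type*} [Group G] {n : ℕ} (g : Fin n ≃ G) (f : G → ℂ) :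
    Matrix (Fin n) (Fin n) ℂ :=
  Matrix.of fun i j => f (g i * (g j)⁻¹)

/-- The normalized matrix `(χ(e) / |G|) (χ (gᵢ gⱼ⁻¹))`. -/
noncomputable def charProj {G : Type*} [Group G] {n : ℕ} (g : Fin n ≃ G) (χ : IrrChar G) :
    Matrix (Fin n) (Fin n) ℂ :=
  (χ 1 / (Nat.card G : ℂ)) • gCirculant g χ

/-! The expansion `f = ∑ p r * r` turns the circulant matrix into `∑ (p r * |G| / r 1) • charProj g
r`. Schur's lemma gives the convolution identity that makes the `charProj g r` orthogonal
idempotents; `χ g⁻¹ = star (χ g)` makes them self-adjoint. This is thus a spectral decomposition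
with nonzero projections, so positivity is read off the coefficients, and rank equals trace.
Characters span the class functions because the group algebra is semisimple. -/

namespace Representation

variable {G : Type*} [Group G]

/-- The complex character of a finite group satisfies `χ(g⁻¹) = conj χ(g)`. -/
theorem character_inv_eq_star [Finite G] {d : ℕ} (ρ : Representation ℂ G (Fin d → ℂ)) (x : G) :
    ρ.character x⁻¹ = star (ρ.character x) := by
  have := Fintype.ofFinite G
  let M : G → Matrix (Fin d) (Fin d) ℂ := fun g => LinearMap.toMatrix' (ρ g)
  have hmul : ∀ g h, M (g * h) = M g * M h := fun g h => by
    simp [M, LinearMap.toMatrix'_mul]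
  have hone : M 1 = 1 := by simp [M, Module.End.one_eq_id]
  have htr : ∀ g, ρ.character g = (M g).trace := fun g => by
    rw [← Matrix.trace_toLin'_eq, Matrix.toLin'_toMatrix']; rfl
  -- Averaging gives a `G`-invariant inner product `H`, so `M x⁻¹` is similar to the adjoint of `M
  -- x` and has the same trace.
  let H : Matrix (Fin d) (Fin d) ℂ := ∑ g : G, (M g).conjTranspose * M g
  have hH : H.PosDef := by
    refine Matrix.posDef_sum Finset.univ_nonempty fun g _ => ?_
    refine Matrix.PosDef.conjTranspose_mul_self _ ?_
    refine Function.LeftInverse.injective (g := (M g⁻¹).mulVec) fun v => ?_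
    rw [Matrix.mulVec_mulVec, ← hmul, inv_mul_cancel, hone, Matrix.one_mulVec]
  have hdet : IsUnit H.det := (Matrix.isUnit_iff_isUnit_det _).1 hH.isUnit
  have hcomm : H * M x⁻¹ = (M x).conjTranspose * H := by
    simp only [H, Finset.sum_mul, Finset.mul_sum]
    refine Fintype.sum_equiv (Equiv.mulRight x⁻¹) _ _ fun g => ?_
    rw [Equiv.coe_mulRight, ← mul_assoc, ← Matrix.conjTranspose_mul, ← hmul, mul_assoc, ← hmul,
      inv_mul_cancel_right]
  have hconj : M x⁻¹ = H⁻¹ * ((M x).conjTranspose * H) := by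
    rw [← hcomm, Matrix.nonsing_inv_mul_cancel_left _ _ hdet]
  rw [htr, htr, hconj, Matrix.trace_mul_comm, mul_assoc, Matrix.mul_nonsing_inv _ hdet, mul_one,
    Matrix.trace_conjTranspose]

/-- Schur's lemma for class functions: `∑ g, f(g⁻¹) ρ(g)` acts as a scalar on an irreducible
representation. -/
theorem exists_sum_smul_eq_smul_one [Fintype G] {V : Type*} [AddCommGroup V] [Module ℂ V]
    [FiniteDimensional ℂ V] (ρ : Representation ℂ G V) [ρ.IsIrreducible] {f : G → ℂ}
    (hf : IsClassFunction f) :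
    ∃ c : ℂ, ∑ g : G, f g⁻¹ • ρ g = c • (1 : Module.End ℂ V) ∧
      c * Module.finrank ℂ V = ∑ g : G, f g⁻¹ * ρ.character g := by
  let T : IntertwiningMap ρ ρ :=
    { toLinearMap := ∑ g : G, f g⁻¹ • ρ g
      isIntertwining' := fun h => by
        change (∑ g : G, f g⁻¹ • ρ g) * ρ h = ρ h * ∑ g : G, f g⁻¹ • ρ g
        rw [Finset.sum_mul, Finset.mul_sum]
        refine Fintype.sum_equiv (MulAut.conj h⁻¹).toEquiv _ _ fun g => ?_
        have : f (h⁻¹ * g * h)⁻¹ = f g⁻¹ := by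
          rw [← hf g⁻¹ h]; congr 1; group
        simp only [MulEquiv.toEquiv_eq_coe, MulEquiv.coe_toEquiv, MulAut.conj_apply, inv_inv, this]
        rw [smul_mul_assoc, mul_smul_comm, ← map_mul, ← map_mul]
        congr 2; group }
  obtain ⟨c, hc⟩ := (IsIrreducible.algebraMap_intertwiningMap_bijective_of_isAlgClosed
    (ρ := ρ)).2 T
  have hT : ∑ g : G, f g⁻¹ • ρ g = c • (1 : Module.End ℂ V) :=
    (congrArg IntertwiningMap.toLinearMap hc).symm
  refine ⟨c, hT, ?_⟩
  have := congrArg (LinearMap.trace ℂ V) hT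
  simpa [map_sum, character] using this.symm

/-- A group algebra element which vanishes in all irreducible representations on the spaces `ℂᵈ`
is zero. -/
theorem eq_zero_of_forall_asAlgebraHom_eq_zero [Finite G] (a : MonoidAlgebra ℂ G)
    (h : ∀ (d : ℕ) (ρ : Representation ℂ G (Fin d → ℂ)), ρ.IsIrreducible → ρ.asAlgebraHom a = 0) :
    a = 0 := by
  -- By Maschke the regular module is a sum of simple submodules; an element killing each of them
  -- kills `1`.
  suffices ha : a ∈ (⊤ : Submodule (MonoidAlgebra ℂ G) (MonoidAlgebra ℂ G)).annihilator by
    simpa using Submodule.mem_annihilator.1 ha 1 Submodule.mem_top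
  rw [← IsSemisimpleModule.sSup_simples_eq_top, sSup_eq_iSup', Submodule.annihilator_iSup,
    Submodule.mem_iInf]
  rintro ⟨S, hS : IsSimpleModule _ S⟩
  have : Module.Finite ℂ (MonoidAlgebra ℂ G) :=
    Module.Finite.equiv (MonoidAlgebra.coeffLinearEquiv (M := G) ℂ).symm
  have : Module.Finite ℂ S := inferInstanceAs (Module.Finite ℂ (S.restrictScalars ℂ))
  let e : S ≃ₗ[ℂ] (Fin (Module.finrank ℂ S) → ℂ) := (Module.finBasis ℂ S).equivFun
  let φ : MonoidAlgebra ℂ G →ₐ[ℂ] Module.End ℂ (Fin (Module.finrank ℂ S) → ℂ) :=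
    (e.conjAlgEquiv ℂ).toAlgHom.comp (Algebra.lsmul ℂ ℂ S)
  let ρ : Representation ℂ G (Fin (Module.finrank ℂ S) → ℂ) :=
    (MonoidAlgebra.lift ℂ _ G).symm φ
  have hρ : ρ.asAlgebraHom = φ := (MonoidAlgebra.lift ℂ _ G).apply_symm_apply φ
  have hφ : ∀ (r : MonoidAlgebra ℂ G) (s : S), φ r (e s) = e (r • s) := fun r s => by
    simp [φ, LinearEquiv.conjAlgEquiv_apply]
  let E : S ≃ₗ[MonoidAlgebra ℂ G] ρ.asModule :=
    { e.toAddEquiv.trans ρ.asModuleEquiv.symm.toAddEquiv with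
      map_smul' := fun r s => by
        apply ρ.asModuleEquiv.injective
        simp [asModuleEquiv_map_smul, hρ, hφ] }
  have hirr : ρ.IsIrreducible :=
    (irreducible_iff_isSimpleModule_asModule ρ).2 (IsSimpleModule.congr E.symm)
  refine Submodule.mem_annihilator.2 fun s hs => ?_
  have h0 := hφ a ⟨s, hs⟩
  rw [← hρ, h _ ρ hirr, LinearMap.zero_apply] at h0
  exact congrArg Subtype.val (e.map_eq_zero_iff.1 h0.symm)

end Representation

theorem Matrix.rank_eq_trace_of_isIdempotentElem {K n : Type*} [Field K] [Fintype n]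
    [DecidableEq n] {A : Matrix n n K} (hA : IsIdempotentElem A) : (A.rank : K) = A.trace := by
  have h : IsIdempotentElem (Matrix.toLin' A) := by
    rw [IsIdempotentElem, Module.End.mul_eq_comp, ← Matrix.toLin'_mul, hA.eq]
  rw [← Matrix.trace_toLin'_eq, (LinearMap.IsIdempotentElem.isProj_range _ h).trace]
  rfl

namespace IrrChar

variable {G : Type*} [Group G]

theorem isClassFunction (χ : IrrChar G) : IsClassFunction χ := by
  obtain ⟨d, ρ, -, hχ⟩ := χ.2
  intro g h
  rw [← hχ]
  simpa using ρ.char_conj g h⁻¹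

theorem inv_eq_star [Finite G] (χ : IrrChar G) (x : G) : χ x⁻¹ = star (χ x) := by
  obtain ⟨d, ρ, -, hχ⟩ := χ.2
  rw [← hχ, ρ.character_inv_eq_star]

theorem one_pos (χ : IrrChar G) : 0 < χ 1 := by
  obtain ⟨d, ρ, hρ, hχ⟩ := χ.2
  rw [← hχ, ρ.char_one, Module.finrank_fin_fun]
  rcases Nat.eq_zero_or_pos d with rfl | hd
  · have := (Representation.irreducible_iff_isSimpleModule_asModule ρ).1 hρ
    have hn : Nontrivial ρ.asModule := IsSimpleModule.nontrivial (MonoidAlgebra ℂ G) _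
    have := ρ.asModuleEquiv.symm.toEquiv.nontrivial
    exact (not_subsingleton _ (inferInstance : Subsingleton (Fin 0 → ℂ))).elim
  · exact_mod_cast hd

/-- The convolution identity for irreducible characters. -/
theorem sum_inv_mul_mul [Fintype G] (χ ψ : IrrChar G) [Decidable (χ = ψ)] (x : G) :
    ψ 1 * ∑ g : G, χ g⁻¹ * ψ (g * x) = if χ = ψ then (Nat.card G : ℂ) * ψ x else 0 := by
  obtain ⟨d, ρ, hρ, hψ⟩ := ψ.2
  obtain ⟨c, hc, hcd⟩ := ρ.exists_sum_smul_eq_smul_one χ.isClassFunction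
  have h1 : ∑ g : G, χ g⁻¹ * ψ g = if χ = ψ then (Nat.card G : ℂ) else 0 := by
    rw [← IrrChar.sum_mul_inv]
    exact Fintype.sum_equiv (Equiv.inv G) _ _ fun g => by simp
  -- Multiply the scalar identity by `ρ x` and take traces.
  have h2 : ∑ g : G, χ g⁻¹ * ψ (g * x) = c * ψ x := by
    have := congrArg (fun T => LinearMap.trace ℂ _ (T * ρ x)) hc
    simp only [Finset.sum_mul, smul_mul_assoc, ← map_mul, map_sum, map_smul, one_mul] at this
    rw [← hψ]
    exact this
  rw [h2, ← mul_assoc, mul_comm _ c, ← hψ, ρ.char_one, hcd, hψ, h1]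
  split_ifs <;> simp

/-- A class function orthogonal to all irreducible characters is zero. -/
theorem _root_.IsClassFunction.eq_zero [Fintype G] {f : G → ℂ} (hf : IsClassFunction f)
    (h : ∀ χ : IrrChar G, ∑ g : G, f g * χ g⁻¹ = 0) : f = 0 := by
  -- Orthogonality to each character forces every Schur scalar of this element to vanish; its
  -- coefficient at `x⁻¹` is `f x`.
  have ha : ∑ g : G, MonoidAlgebra.single g (f g⁻¹) = 0 := by
    refine Representation.eq_zero_of_forall_asAlgebraHom_eq_zero _ fun d ρ hρ => ?_
    obtain ⟨c, hc, hcd⟩ := ρ.exists_sum_smul_eq_smul_one hf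
    have hχ := h ⟨ρ.character, d, ρ, hρ, rfl⟩
    have hpos := (one_pos ⟨ρ.character, d, ρ, hρ, rfl⟩).ne'
    simp only [ρ.char_one] at hpos
    have h0 : ∑ g : G, f g⁻¹ * ρ.character g = 0 := by
      rw [← hχ]
      exact Fintype.sum_equiv (Equiv.inv G) _ _ fun g => by simp
    rw [h0] at hcd
    simp only [map_sum, Representation.asAlgebraHom_single, hc,
      (mul_eq_zero.1 hcd).resolve_right hpos, zero_smul]
  funext x
  have := DFunLike.congr_fun (congrArg MonoidAlgebra.coeff ha) x⁻¹
  classical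
  simpa [Finsupp.finsetSum_apply, Finsupp.single_apply] using this

theorem eq_sum_smul_iff [Fintype G] {f : G → ℂ} (hf : IsClassFunction f) (p : IrrChar G → ℂ) :
    (∀ x : G, f x = ∑ r : IrrChar G, p r * r x) ↔
      p = fun r => (∑ g : G, f g * r g⁻¹) / Nat.card G := by
  classical
  have hc : (Nat.card G : ℂ) ≠ 0 := Nat.cast_ne_zero.2 Nat.card_pos.ne'
  have hcoef : ∀ (q : IrrChar G → ℂ) (r : IrrChar G),
      ∑ g : G, (∑ s : IrrChar G, q s * s g) * r g⁻¹ = q r * Nat.card G := fun q r => by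
    simp only [Finset.sum_mul, mul_assoc]
    rw [Finset.sum_comm]
    simp [← Finset.mul_sum, IrrChar.sum_mul_inv]
  constructor
  · intro h
    funext r
    simp only [h, hcoef]
    field_simp
  · rintro rfl
    set p : IrrChar G → ℂ := fun r => (∑ g : G, f g * r g⁻¹) / Nat.card G with hp
    -- The remainder after subtracting the Fourier expansion is orthogonal to every character.
    have hcl : IsClassFunction fun x => f x - ∑ r : IrrChar G, p r * r x := fun g h => by
      simp only [hf g h, fun r : IrrChar G => r.isClassFunction g h]
    have := hcl.eq_zero fun χ => by
      simp only [sub_mul, Finset.sum_sub_distrib, hcoef]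
      simp [hp]
    exact fun x => sub_eq_zero.1 (congrFun this x)

end IrrChar

section charProj

variable {G : Type*} [Group G] [Finite G] {n : ℕ} (g : Fin n ≃ G)

omit [Finite G] in
theorem charProj_apply (χ : IrrChar G) (i j : Fin n) :
    charProj g χ i j = χ 1 / (Nat.card G : ℂ) * χ (g i * (g j)⁻¹) := rfl

theorem charProj_mul (χ ψ : IrrChar G) [Decidable (χ = ψ)] :
    charProj g χ * charProj g ψ = if χ = ψ then charProj g ψ else 0 := by
  have := Fintype.ofFinite G
  have hc : (Nat.card G : ℂ) ≠ 0 := Nat.cast_ne_zero.2 Nat.card_pos.ne'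
  ext i j
  have h := IrrChar.sum_inv_mul_mul χ ψ (g i * (g j)⁻¹)
  have hs : ∑ k, χ (g i * (g k)⁻¹) * ψ (g k * (g j)⁻¹) =
      ∑ x : G, χ x⁻¹ * ψ (x * (g i * (g j)⁻¹)) := by
    refine Fintype.sum_equiv (g.trans (Equiv.mulRight (g i)⁻¹)) _ _ fun k => ?_
    simp [mul_assoc]
  rw [← hs] at h
  have : (charProj g χ * charProj g ψ) i j = χ 1 / (Nat.card G : ℂ) / (Nat.card G : ℂ) *
      (ψ 1 * ∑ k, χ (g i * (g k)⁻¹) * ψ (g k * (g j)⁻¹)) := by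
    simp only [Matrix.mul_apply, charProj_apply, Finset.mul_sum]
    exact Finset.sum_congr rfl fun k _ => by ring
  rw [this, h]
  split_ifs with hE
  · subst hE
    rw [charProj_apply]
    field_simp
  · simp

theorem isStarProjection_charProj (χ : IrrChar G) : IsStarProjection (charProj g χ) := by
  classical
  refine ⟨by simp [IsIdempotentElem, charProj_mul], ?_⟩
  ext i j
  have h1 : star (χ 1) = χ 1 := by rw [← χ.inv_eq_star, inv_one]
  rw [Matrix.star_apply, charProj_apply, charProj_apply, star_mul', star_div₀, h1,
    ← χ.inv_eq_star]
  simp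

theorem trace_charProj (χ : IrrChar G) : (charProj g χ).trace = χ 1 ^ 2 := by
  have hc : (Nat.card G : ℂ) ≠ 0 := Nat.cast_ne_zero.2 Nat.card_pos.ne'
  have hn : Nat.card G = n := by simpa using (Nat.card_congr g).symm
  simp only [Matrix.trace, Matrix.diag_apply, charProj_apply, mul_inv_cancel, Finset.sum_const,
    Finset.card_univ, Fintype.card_fin, nsmul_eq_mul, ← hn]
  field_simp

theorem gCirculant_eq_sum {f : G → ℂ} {p : IrrChar G → ℂ}
    (h : ∀ x : G, f x = ∑ r : IrrChar G, p r * r x) :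
    gCirculant g f = ∑ r : IrrChar G, (p r * (Nat.card G / r 1)) • charProj g r := by
  have hc : (Nat.card G : ℂ) ≠ 0 := Nat.cast_ne_zero.2 Nat.card_pos.ne'
  ext i j
  simp only [Matrix.sum_apply, Matrix.smul_apply, charProj_apply, smul_eq_mul, gCirculant,
    Matrix.of_apply, h]
  refine Finset.sum_congr rfl fun r _ => ?_
  have := r.one_pos.ne'
  field_simp

theorem posSemidef_gCirculant_iff {f : G → ℂ} {p : IrrChar G → ℂ}
    (h : ∀ x : G, f x = ∑ r : IrrChar G, p r * r x) :
    (gCirculant g f).PosSemidef ↔ ∀ r : IrrChar G, 0 ≤ p r := by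
  classical
  have hc : (0 : ℂ) < Nat.card G := by exact_mod_cast Nat.card_pos
  have hsa : ∀ r : IrrChar G, (charProj g r).conjTranspose = charProj g r :=
    fun r => (isStarProjection_charProj g r).isSelfAdjoint
  rw [gCirculant_eq_sum g h]
  constructor
  · intro hA r
    -- Compressing by `charProj g r` isolates the `r`-th term, whose trace is `p r * |G| * r 1`.
    have h0 := (hA.conjTranspose_mul_mul_same (charProj g r)).trace_nonneg
    rw [hsa, Finset.mul_sum] at h0
    simp only [Matrix.mul_smul, charProj_mul, smul_ite, smul_zero, Finset.sum_ite_eq,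
      Finset.mem_univ, if_true, Matrix.smul_mul, Matrix.trace_smul, trace_charProj,
      smul_eq_mul] at h0
    refine le_of_mul_le_mul_right ?_ (mul_pos hc r.one_pos)
    rw [zero_mul]
    convert h0 using 1
    have := r.one_pos.ne'
    field_simp
  · intro hp
    refine Matrix.posSemidef_sum _ fun r _ => Matrix.PosSemidef.smul ?_
      (mul_nonneg (hp r) (div_nonneg hc.le r.one_pos.le))
    have := Matrix.posSemidef_conjTranspose_mul_self (charProj g r)
    rwa [hsa, (isStarProjection_charProj g r).isIdempotentElem.eq] at this

end charProj

theorem mainTheorem5 {G : Type*} [Group G] [Finite G] {n : ℕ} (g : Fin n ≃ G) :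
    (∀ f : G → ℂ, IsClassFunction f →
      (∃! p : IrrChar G → ℂ, ∀ x : G, f x = ∑ r : IrrChar G, p r * r x) ∧
      ∀ p : IrrChar G → ℂ, (∀ x : G, f x = ∑ r : IrrChar G, p r * r x) →
        ((gCirculant g f).PosSemidef ↔ ∀ r : IrrChar G, 0 ≤ p r)) ∧
    (∀ r : IrrChar G, IsStarProjection (charProj g r)) ∧
    (∀ r s : IrrChar G, r ≠ s → charProj g r * charProj g s = 0) ∧
    (∀ r : IrrChar G, ((charProj g r).rank : ℂ) = r 1 ^ 2) := by
  classical
  have := Fintype.ofFinite G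
  refine ⟨fun f hf => ⟨⟨_, (IrrChar.eq_sum_smul_iff hf _).2 rfl,
      fun p hp => (IrrChar.eq_sum_smul_iff hf p).1 hp⟩,
      fun p hp => posSemidef_gCirculant_iff g hp⟩,
    isStarProjection_charProj g, fun r s hrs => by rw [charProj_mul, if_neg hrs], fun r => ?_⟩
  rw [Matrix.rank_eq_trace_of_isIdempotentElem (isStarProjection_charProj g r).isIdempotentElem,
    trace_charProj]
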